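/- Let $\alpha,\beta$ be non-zero complex numbers with $m\alpha+n\beta=0$ for relatively prime positive integers $m,n$. Consider the equation $$p(u)q(u)=p(u+\beta)\,q(u+\alpha),\qquad (*)$$ for $p,q\in\mathbb{C}[u]$; products of pairs are taken componentwise. A solution $(p,q)\neq(1,1)$ of $(*)$ with $p,q$ monic is called irreducible if, whenever $(p,q)=(p_1,q_1)(p_2,q_2)$ with both $(p_i,q_i)$ solutions of $(*)$, either $p_1,q_1$ are both constant or $p_2,q_2$ are both constant. For a coset $c\in\mathbb{C}/(\mathbb{Z}\alpha+\mathbb{Z}\beta)$, a solution with $p,q$ monic is called $c$-integral if every zero of $p(u)q(u)$ lies in $c$. Let $\mathscr{D}(m,n)$ be the set of generalized Dyck paths $\pi=((x_0,y_0),\dots,(x_{m+n},y_{m+n}))$, that is, sequences of points of $\mathbb{Z}_{\ge0}^2$ from $(0,0)$ to $(m,n)$ in which each step is $(1,0)$ or $(0,1)$ and $m y_i\ge n x_i$ for all $i$. For $\pi\in\mathscr{D}(m,n)$ and $\lambda\in\mathbb{C}$ put $$P_1^{\pi,\lambda}(u)=\prod_{\substack{1\le i\le m+n\\ x_i=x_{i-1}}}\bigl(u-(\lambda+x_i\alpha+y_i\beta)\bigr),\qquad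 P_2^{\pi,\lambda}(u)=\prod_{\substack{1\le i\le m+n\\ y_i=y_{i-1}}}\bigl(u-(\lambda+x_i\alpha+y_i\beta)\bigr).$$ Fix a coset $c$ and an origin $z_0\in c$. Every $\lambda\in c$ is uniquely $\lambda=z_0+k\alpha+l\beta$ with $0\le k\le m-1$, $l\in\mathbb{Z}$; to $(\pi,\lambda)\in\mathscr{D}(m,n)\times c$ one associates the cylindrical Dyck path $\overline{\pi}_{kl}$, the sequence of the classes of $(x_i+k,y_i+l)$, $0\le i\le m+n$, in the cylinder $\mathbb{Z}^2/\mathbb{Z}(m,n)$. Write $(\pi,\lambda)\preceq(\tau,\mu)$ if the cylindrical path of $(\pi,\lambda)$ lies to the south-east of that of $(\tau,\mu)$: whenever the classes of $(x,y)\in\mathbb{Z}^2$ and $(x',y')\in\mathbb{Z}^2$ are points of the first and of the second path respectively, and $x+y=x'+y'$, then $y-x\le y'-x'$. Then, for every choice of $z_0\in c$ and every $c$-integral solution $(p,q)$, there exist a unique integer $k\ge0$ and a unique sequence $\bigl((\pi_1,\lambda_1),\dots,(\pi_k,\lambda_k)\bigr)$ of elements of $\mathscr{D}(m,n)\times c$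 such that $$(\pi_1,\lambda_1)\preceq(\pi_2,\lambda_2)\preceq\cdots\preceq(\pi_k,\lambda_k)\qquad\text{and}\qquad (p,q)=\prod_{i=1}^{k}\bigl(P_1^{\pi_i,\lambda_i},P_2^{\pi_i,\lambda_i}\bigr).$$ Moreover, every pair $(P_1^{\pi,\lambda},P_2^{\pi,\lambda})$ with $(\pi,\lambda)\in\mathscr{D}(m,n)\times c$ is an irreducible solution of $(*)$. -/

import Mathlib

open Polynomial

namespace ShiftEq

/-- `(p, q)` solves `p(u) q(u) = p(u + β) q(u + α)`. -/
def IsSolution (α β : ℂ) (P : ℂ[X] × ℂ[X]) : Prop :=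
  P.1 * P.2 = P.1.comp (X + C β) * P.2.comp (X + C α)

/-- A solution in which both polynomials are monic (hence non-zero). -/
def IsMonicSolution (α β : ℂ) (P : ℂ[X] × ℂ[X]) : Prop :=
  P.1.Monic ∧ P.2.Monic ∧ IsSolution α β P

/-- Irreducible solutions: non-trivial monic solutions such that, in every factorization into two
(not necessarily monic) solutions, one of the two factors consists of constants. -/
def IsIrreducibleSolution (α β : ℂ) (P : ℂ[X] × ℂ[X]) : Prop :=
  IsMonicSolution α β P ∧ P ≠ 1 ∧
    ∀ A B : ℂ[X] × ℂ[X], IsSolution α β A → IsSolution α β B → P = A * B →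
      (A.1.natDegree = 0 ∧ A.2.natDegree = 0) ∨ (B.1.natDegree = 0 ∧ B.2.natDegree = 0)

/-- The subgroup `ℤα + ℤβ` of `ℂ`. -/
def latticeGroup (α β : ℂ) : AddSubgroup ℂ :=
  AddSubgroup.zmultiples α ⊔ AddSubgroup.zmultiples β

/-- `c`-integral solutions: monic solutions such that all zeros of `p q` lie in the coset `c`. -/
def IsIntegralSolution (α β : ℂ) (c : ℂ ⧸ latticeGroup α β) (P : ℂ[X] × ℂ[X]) : Prop :=
  IsMonicSolution α β P ∧
    ∀ z : ℂ, (P.1 * P.2).IsRoot z → (z : ℂ ⧸ latticeGroup α β) = c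

/-- Generalized Dyck paths from `(0,0)` to `(m,n)`: the points `(x_0,y_0), …, (x_{m+n},y_{m+n})` of
a lattice path with unit steps to the right and up, with `m y_i ≥ n x_i` for all `i`. (A lattice
path with these end points necessarily has `m + n` steps.) -/
@[ext] structure DyckPath (m n : ℕ) where
  pt : Fin (m + n + 1) → ℕ × ℕ
  start : pt 0 = (0, 0)
  finish : pt (Fin.last (m + n)) = (m, n)
  step : ∀ i : Fin (m + n),
    pt i.succ = ((pt i.castSucc).1 + 1, (pt i.castSucc).2) ∨
      pt i.succ = ((pt i.castSucc).1, (pt i.castSucc).2 + 1)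
  above : ∀ i : Fin (m + n + 1), n * (pt i).1 ≤ m * (pt i).2

/-- The pair `(P₁^{π,z}, P₂^{π,z})`: the first (second) polynomial has the factor
`u - (z + x_i α + y_i β)` for each `i = 1, …, m + n` with `x_i = x_{i-1}` (`y_i = y_{i-1}`). -/
noncomputable def pathSolution (α β : ℂ) {m n : ℕ} (π : DyckPath m n) (z : ℂ) : ℂ[X] × ℂ[X] :=
  (∏ i : Fin (m + n),
      (X - C (z + ((π.pt i.succ).1 : ℂ) * α + ((π.pt i.succ).2 : ℂ) * β)) ^
        (if (π.pt i.succ).1 = (π.pt i.castSucc).1 then 1 else 0),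
   ∏ i : Fin (m + n),
      (X - C (z + ((π.pt i.succ).1 : ℂ) * α + ((π.pt i.succ).2 : ℂ) * β)) ^
        (if (π.pt i.succ).2 = (π.pt i.castSucc).2 then 1 else 0))

/-- The discrete cylinder `ℤ² / ℤ(m,n)`. -/
abbrev Cylinder (m n : ℕ) : Type :=
  (ℤ × ℤ) ⧸ AddSubgroup.zmultiples ((m : ℤ), (n : ℤ))

/-- The sequence on the cylinder obtained by translating `π` by `(k,l)` and projecting. -/
def cylSeq {m n : ℕ} (π : DyckPath m n) (k l : ℤ) : Fin (m + n + 1) → Cylinder m n :=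
  fun i => QuotientAddGroup.mk (((π.pt i).1 : ℤ) + k, ((π.pt i).2 : ℤ) + l)

/-- Cylindrical Dyck paths: the sequences `cylSeq π k l` with `0 ≤ k ≤ m - 1` and `l ∈ ℤ`. -/
def CylDyckPath (m n : ℕ) : Type :=
  {γ : Fin (m + n + 1) → Cylinder m n //
    ∃ (π : DyckPath m n) (k l : ℤ), 0 ≤ k ∧ k < (m : ℤ) ∧ γ = cylSeq π k l}

/-- `γ` lies completely to the south-east of `δ`. -/
def CylDyckPath.SouthEast {m n : ℕ} (γ δ : CylDyckPath m n) : Prop :=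
  ∀ x y x' y' : ℤ,
    (QuotientAddGroup.mk (x, y) : Cylinder m n) ∈ Set.range γ.1 →
    (QuotientAddGroup.mk (x', y') : Cylinder m n) ∈ Set.range δ.1 →
    x + y = x' + y' → y - x ≤ y' - x'

/-- The set `𝒟(m,n) × c`. -/
abbrev PathIn (m n : ℕ) {α β : ℂ} (c : ℂ ⧸ latticeGroup α β) : Type :=
  DyckPath m n × {z : ℂ // (z : ℂ ⧸ latticeGroup α β) = c}

/-- With origin `z₀`, the pair `(π, z₀ + k α + l β)` with `0 ≤ k ≤ m - 1` corresponds to the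
cylindrical Dyck path `cylSeq π k l`. -/
def CorrespondsTo {m n : ℕ} {α β : ℂ} {c : ℂ ⧸ latticeGroup α β} (z₀ : ℂ)
    (a : PathIn m n c) (γ : CylDyckPath m n) : Prop :=
  ∃ k l : ℤ, 0 ≤ k ∧ k < (m : ℤ) ∧ (a.2 : ℂ) = z₀ + (k : ℂ) * α + (l : ℂ) * β ∧
    γ.1 = cylSeq a.1 k l

/-- The correspondence is a well-defined map `𝒟(m,n) × c → 𝒟^cyl(m,n)` for every origin in `c`. -/
theorem existsUnique_correspondsTo {m n : ℕ} {α β : ℂ} (hβ : β ≠ 0)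
    (hm : 0 < m) (hmn : Nat.Coprime m n) (h : (m : ℂ) * α + (n : ℂ) * β = 0)
    {c : ℂ ⧸ latticeGroup α β} (z₀ : ℂ) (hz₀ : (z₀ : ℂ ⧸ latticeGroup α β) = c)
    (a : PathIn m n c) : ∃! γ : CylDyckPath m n, CorrespondsTo z₀ a γ := by
  obtain ⟨π, z, hz⟩ := a
  have hmem : -z₀ + z ∈ latticeGroup α β := QuotientAddGroup.eq.1 (hz₀.trans hz.symm)
  obtain ⟨_, ⟨k, rfl⟩, _, ⟨l, rfl⟩, hkl⟩ := AddSubgroup.mem_sup.1 hmem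
  simp only [zsmul_eq_mul] at hkl
  have hm' : (m : ℤ) ≠ 0 := by exact_mod_cast hm.ne'
  have hk : (k : ℂ) = (m : ℂ) * ((k / m : ℤ) : ℂ) + ((k % m : ℤ) : ℂ) := by
    exact_mod_cast (Int.mul_ediv_add_emod k m).symm
  refine ⟨⟨cylSeq π (k % m) (l - n * (k / m)), π, _, _, Int.emod_nonneg _ hm',
    Int.emod_lt_of_pos _ (by omega), rfl⟩, ⟨k % m, l - n * (k / m), Int.emod_nonneg _ hm',
    Int.emod_lt_of_pos _ (by omega), ?_, rfl⟩, ?_⟩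
  · push_cast
    linear_combination (-1 : ℂ) * hkl + α * hk + ((k / m : ℤ) : ℂ) * h
  · rintro ⟨γ, hγ⟩ ⟨k', l', h0, h1, h2, h3⟩
    apply Subtype.ext
    change z = _ at h2
    have e : (k' - k) * (n : ℤ) = (l' - l) * m := by
      have : ((k' - k) * (n : ℂ) - (l' - l) * m) * β = 0 := by
        linear_combination (k' - k : ℂ) * h + (m : ℂ) * h2 + (m : ℂ) * hkl
      have := (mul_eq_zero.1 this).resolve_right hβ
      exact_mod_cast sub_eq_zero.1 this
    have hd : (m : ℤ) ∣ k' - k :=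
      IsCoprime.dvd_of_dvd_mul_right (Nat.isCoprime_iff_coprime.2 hmn) (e ▸ dvd_mul_left _ _)
    have hk' : k % m = k' := by
      have e2 : k % m = k' % m := Int.modEq_iff_dvd.2 hd
      rw [e2, Int.emod_eq_of_lt h0 h1]
    have hl' : l - n * (k / m) = l' := by
      have := Int.mul_ediv_add_emod k m
      apply mul_right_cancel₀ hm'
      rw [hk'] at this
      linear_combination e - (n : ℤ) * this
    change γ = cylSeq π k' l' at h3
    change γ = cylSeq π (k % m) (l - n * (k / m))
    rw [h3, hk', hl']

/-- The order on `𝒟(m,n) × c` transferred from cylindrical Dyck paths by means of the origin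
`z₀`. -/
def SouthEast {m n : ℕ} {α β : ℂ} {c : ℂ ⧸ latticeGroup α β} (z₀ : ℂ)
    (a b : PathIn m n c) : Prop :=
  ∃ γ δ : CylDyckPath m n, CorrespondsTo z₀ a γ ∧ CorrespondsTo z₀ b δ ∧ γ.SouthEast δ

end ShiftEq

open ShiftEq

/-! Write the points of the coset as `z₀ - e (α / n)` with an integer level `e`. Adding `β` raises
the level by `m`, and adding `α` lowers it by `n`. Let `a e` and `b e` be the multiplicities of the
level-`e` point as a root of `p` and of `q`. Then (*) reads `a e + b e = a (e + m) + b (e - n)`: a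
finite circulation on `ℤ` with edges `e ⟶ e + m` and `e ⟶ e - n`.

Put `C e = ∑_{k ≥ 0} (a + b)(e - k (m + n))`. Conservation of flow gives `b e = C e - C (e - m)` and
`a e = C (e - m) - C (e - m - n)`. So `C` and the circulation determine each other, products of
solutions become sums of profiles, and `C` does not decrease under adding `m` or `n`.

For a Dyck path, `C` is the indicator function of a set that is bounded below and closed under
adding `m` and `n`. The steps, taken modulo `m + n`, visit each residue class once, and the path
records the least element of the set in each class. Every non-empty such set arises from exactly one
rooted path (`exists_path_of_set`, `pathProfile_injective`), and lying to the south-east means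
having the larger set (`cylSeq_southEast_iff`). A chain of paths is thus a decreasing family of
sets, and the only way to write `C` as a sum of nested indicators is by its superlevel sets `{C >
i}`.

Irreducibility: coprimality makes any two non-zero profiles overlap (`exists_two_le`), so their sum
takes a value at least `2`, whereas a path has profile at most `1`. -/

namespace ShiftEq

/-! ### Profiles of circulations on `ℤ` with edges `e ⟶ e + m` and `e ⟶ e - n` -/

/-- `C` is the cumulative count of the circulation which has `a e` up-edges and `b e` down-edges
ending in `e`. -/
structure IsProfile (m n : ℕ) (a b C : ℤ → ℕ) : Prop where
  low : ∃ B : ℤ, ∀ e < B, C e = 0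
  up : ∀ e, a e + C (e - (m + n)) = C (e - m)
  down : ∀ e, b e + C (e - m) = C e

/-- Descend by periods until the bound is passed. Identities between profiles are proved by applying
this to their defect. -/
lemma eq_zero_of_periodic_of_low {M : ℤ} (hM : 0 < M) {D : ℤ → ℤ} (hp : ∀ e, D e = D (e - M))
    (hl : ∃ B : ℤ, ∀ e < B, D e = 0) (e : ℤ) : D e = 0 := by
  obtain ⟨B, hB⟩ := hl
  have key : ∀ k : ℕ, D e = D (e - k * M) := by
    intro k
    induction k with
    | zero => simp
    | succ k ih =>
      rw [ih, hp]
      congr 1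
      push_cast
      ring
  rw [key ((e - B).toNat + 1)]
  apply hB
  have := Int.self_le_toNat (e - B)
  push_cast
  nlinarith

namespace IsProfile

variable {m n : ℕ} {a b C a' b' C' : ℤ → ℕ}

lemma total (h : IsProfile m n a b C) (e : ℤ) : a e + b e + C (e - (m + n)) = C e := by
  have := h.up e
  have := h.down e
  omega

lemma add_m (h : IsProfile m n a b C) (e : ℤ) : C e ≤ C (e + m) := by
  have := h.down (e + m)
  rw [add_sub_cancel_right] at this
  omega

lemma add_n (h : IsProfile m n a b C) (e : ℤ) : C e ≤ C (e + n) := by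
  have := h.up (e + (m + n))
  rw [add_sub_cancel_right, show e + (m + n : ℤ) - m = e + n by ring] at this
  omega

lemma unique (hm : 0 < m) (h : IsProfile m n a b C) (h' : IsProfile m n a b C') : C = C' := by
  funext e
  have := eq_zero_of_periodic_of_low (M := m + n) (by omega) (D := fun e => (C e : ℤ) - C' e)
    (fun e => by have := h.total e; have := h'.total e; omega)
    (by
      obtain ⟨B, hB⟩ := h.low
      obtain ⟨B', hB'⟩ := h'.low
      exact ⟨min B B', fun e he => by
        rw [hB e (by omega), hB' e (by omega)]; simp⟩) e
  omega

lemma add (h : IsProfile m n a b C) (h' : IsProfile m n a' b' C') :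
    IsProfile m n (fun e => a e + a' e) (fun e => b e + b' e) (fun e => C e + C' e) where
  low := by
    obtain ⟨B, hB⟩ := h.low
    obtain ⟨B', hB'⟩ := h'.low
    exact ⟨min B B', fun e he => by rw [hB e (by omega), hB' e (by omega)]⟩
  up e := by have := h.up e; have := h'.up e; omega
  down e := by have := h.down e; have := h'.down e; omega

lemma zero : IsProfile m n (fun _ => 0) (fun _ => 0) (fun _ => 0) :=
  ⟨⟨0, fun _ _ => rfl⟩, fun _ => rfl, fun _ => rfl⟩

lemma add_mul (h : IsProfile m n a b C) (e : ℤ) (x y : ℕ) : C e ≤ C (e + x * m + y * n) := by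
  have h1 : C e ≤ C (e + x * m) := by
    induction x with
    | zero => simp
    | succ x ih =>
      refine (ih.trans (h.add_m _)).trans_eq (congrArg C ?_)
      push_cast
      ring
  refine h1.trans ?_
  induction y with
  | zero => simp
  | succ y ih =>
    refine (ih.trans (h.add_n _)).trans_eq (congrArg C ?_)
    push_cast
    ring

/-- Two circulations that are both non-trivial overlap at some level. -/
lemma exists_two_le (hmn : Nat.Coprime m n) (h : IsProfile m n a b C)
    (h' : IsProfile m n a' b' C') {e₁ e₂ : ℤ} (h₁ : C e₁ ≠ 0) (h₂ : C' e₂ ≠ 0) :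
    ∃ e, 2 ≤ C e + C' e := by
  obtain ⟨u, v, huv⟩ := Nat.isCoprime_iff_coprime.2 hmn
  set x := (e₂ - e₁) * u
  set y := (e₂ - e₁) * v
  have hxy : x * m + y * n = e₂ - e₁ := by linear_combination (e₂ - e₁) * huv
  -- With `e₂ - e₁ = x m + y n`, move `e₁` up by the positive parts of `x, y` and `e₂` up by the
  -- negative parts; both reach the same level.
  have k1 := h.add_mul e₁ x.toNat y.toNat
  have k2 := h'.add_mul e₂ (-x).toNat (-y).toNat
  refine ⟨e₁ + x.toNat * m + y.toNat * n, ?_⟩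
  have : e₂ + (-x).toNat * m + (-y).toNat * n = e₁ + x.toNat * m + y.toNat * n := by
    have hx := Int.toNat_sub_toNat_neg x
    have hy := Int.toNat_sub_toNat_neg y
    linear_combination (-1 : ℤ) * hxy - (m : ℤ) * hx - (n : ℤ) * hy
  rw [this] at k2
  omega

end IsProfile

/-- `levelCount m n v e` is `1` if `v ≤ e` and `v ≡ e` modulo `m + n`, and `0` otherwise. -/
def levelCount (m n : ℕ) (v e : ℤ) : ℕ :=
  if v ≤ e ∧ (m + n : ℤ) ∣ e - v then 1 else 0

section levelCount

variable {m n : ℕ}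

lemma levelCount_le_one (v e : ℤ) : levelCount m n v e ≤ 1 := by
  unfold levelCount
  split_ifs <;> simp

lemma levelCount_add (v e d : ℤ) : levelCount m n (v + d) (e + d) = levelCount m n v e := by
  simp [levelCount]

lemma levelCount_sub_period (hm : 0 < m) (v e : ℤ) :
    (if v = e then 1 else 0) + levelCount m n v (e - (m + n)) = levelCount m n v e := by
  unfold levelCount
  have hd : (m + n : ℤ) ∣ e - (m + n) - v ↔ (m + n : ℤ) ∣ e - v := by
    rw [show e - (m + n : ℤ) - v = e - v - (m + n) by ring, dvd_sub_self_right]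
  simp only [hd]
  rcases eq_or_ne v e with rfl | hne
  · have : ¬ v ≤ v - (m + n : ℤ) := by omega
    simp [this]
  · by_cases h1 : (m + n : ℤ) ∣ e - v
    · have : v ≤ e - (m + n : ℤ) ↔ v ≤ e := by
        refine ⟨fun h => by omega, fun h => ?_⟩
        have := Int.le_of_dvd (by omega) h1
        omega
      simp [hne, this]
    · simp [hne, h1]

lemma levelCount_eq_zero {v e : ℤ} (h : e < v) : levelCount m n v e = 0 := by
  simp [levelCount, h]

end levelCount

/-- Every finitely supported circulation has a bounded profile. -/
lemma exists_isProfile {m n : ℕ} (hm : 0 < m) {a b : ℤ → ℕ} (S : Finset ℤ)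
    (hS : ∀ e ∉ S, a e + b e = 0) (hflow : ∀ e, a e + b e = a (e + m) + b (e - n)) :
    ∃ C, IsProfile m n a b C ∧ ∃ K, ∀ e, C e ≤ K := by
  set C : ℤ → ℕ := fun e => ∑ v ∈ S, (a v + b v) * levelCount m n v e with hC
  have low : ∃ B : ℤ, ∀ e < B, C e = 0 ∧ b e = 0 := by
    obtain ⟨B, hB⟩ := S.bddBelow
    refine ⟨B, fun e he => ⟨Finset.sum_eq_zero fun v hv => ?_, ?_⟩⟩
    · rw [levelCount_eq_zero (he.trans_le (hB hv)), mul_zero]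
    · have := hS e fun h => absurd (hB h) (by omega)
      omega
  have total : ∀ e, a e + b e + C (e - (m + n)) = C e := by
    intro e
    have : ∑ v ∈ S, (a v + b v) * (if v = e then 1 else 0) = a e + b e := by
      by_cases he : e ∈ S
      · simp [he]
      · simp [he, hS e he]
    rw [← this, hC, ← Finset.sum_add_distrib]
    refine Finset.sum_congr rfl fun v _ => ?_
    rw [← mul_add, levelCount_sub_period hm]
  -- The defect `C e - C (e - m) - b e` is `(m + n)`-periodic by conservation of flow at `e - m`,
  -- and it vanishes far down.
  have down : ∀ e, b e + C (e - m) = C e := by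
    intro e
    have := eq_zero_of_periodic_of_low (M := m + n) (by omega)
      (D := fun e => (C e : ℤ) - C (e - m) - b e)
      (fun e => by
        have h1 := total e
        have h2 := total (e - m)
        have h3 := hflow (e - m)
        rw [sub_add_cancel, show e - m - (n : ℤ) = e - (m + n) by ring] at h3
        rw [show e - m - (m + n : ℤ) = e - (m + n) - m by ring] at h2
        omega)
      (by
        obtain ⟨B, hB⟩ := low
        exact ⟨B, fun e he => by
          rw [(hB e he).1, (hB e he).2, (hB (e - m) (by omega)).1]; simp⟩) e
    omega
  refine ⟨C, ⟨?_, fun e => ?_, down⟩, ∑ v ∈ S, (a v + b v), fun e => ?_⟩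
  · obtain ⟨B, hB⟩ := low
    exact ⟨B, fun e he => (hB e he).1⟩
  · have := total e
    have := down e
    omega
  · refine Finset.sum_le_sum fun v _ => ?_
    exact (Nat.mul_le_mul_left _ (levelCount_le_one v e)).trans_eq (mul_one _)

/-! ### Rooted paths and their profiles -/

/-- The level of the `i`-th point of the path `π` rooted at level `t`. -/
def level {m n : ℕ} (π : DyckPath m n) (t : ℤ) (i : Fin (m + n + 1)) : ℤ :=
  t + m * (π.pt i).2 - n * (π.pt i).1

/-- The profile of the path `π` rooted at level `t`. -/
def pathProfile {m n : ℕ} (π : DyckPath m n) (t e : ℤ) : ℕ :=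
  ∑ i : Fin (m + n), levelCount m n (level π t i.succ) e

section paths

variable {m n : ℕ} (π : DyckPath m n) (t : ℤ)

lemma pt_add (i : Fin (m + n + 1)) : (π.pt i).1 + (π.pt i).2 = i := by
  induction i using Fin.induction with
  | zero => simp [π.start]
  | succ i ih =>
    rw [Fin.val_castSucc] at ih
    rw [Fin.val_succ]
    rcases π.step i with h | h <;> rw [h] <;> dsimp only <;> omega

lemma level_zero : level π t 0 = t := by simp [level, π.start]

lemma level_last : level π t (Fin.last _) = t := by
  simp [level, π.finish]
  ring

/-- The Dyck condition says exactly that the root is the lowest level. -/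
lemma le_level (i : Fin (m + n + 1)) : t ≤ level π t i := by
  have : (n * (π.pt i).1 : ℤ) ≤ m * (π.pt i).2 := by exact_mod_cast π.above i
  unfold level
  omega

lemma level_step (i : Fin (m + n)) :
    ((π.pt i.succ).1 = (π.pt i.castSucc).1 ∧ (π.pt i.succ).2 ≠ (π.pt i.castSucc).2 ∧
      level π t i.succ = level π t i.castSucc + m) ∨
    ((π.pt i.succ).1 ≠ (π.pt i.castSucc).1 ∧ (π.pt i.succ).2 = (π.pt i.castSucc).2 ∧
      level π t i.succ = level π t i.castSucc - n) := by
  unfold level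
  rcases π.step i with h | h
  · right
    rw [h]
    refine ⟨by simp, rfl, ?_⟩
    push_cast
    ring
  · left
    rw [h]
    refine ⟨rfl, by simp, ?_⟩
    push_cast
    ring

/-- Since `-n ≡ m` modulo `m + n`, both kinds of step add `m`, so the residue of the level depends
only on the time. -/
lemma level_modEq (i : Fin (m + n + 1)) : (m + n : ℤ) ∣ t + m * (i : ℕ) - level π t i := by
  rw [← pt_add π i]
  exact ⟨(π.pt i).1, by unfold level; push_cast; ring⟩

lemma dvd_index_sub (hmn : Nat.Coprime m n) {i j : ℤ} (h : (m + n : ℤ) ∣ m * i - m * j) :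
    (m + n : ℤ) ∣ i - j := by
  rw [← mul_sub] at h
  refine IsCoprime.dvd_of_dvd_mul_left ?_ h
  have : IsCoprime (n : ℤ) m := (Nat.isCoprime_iff_coprime.2 hmn).symm
  simpa [add_comm] using IsCoprime.add_mul_left_left this 1

/-- Congruent levels on two paths with the same root belong to the same time, up to the period. -/
lemma dvd_sub_of_level (hmn : Nat.Coprime m n) (τ : DyckPath m n) {i j : Fin (m + n + 1)}
    (h : (m + n : ℤ) ∣ level π t i - level τ t j) : (m + n : ℤ) ∣ (i : ℕ) - (j : ℕ) := by
  apply dvd_index_sub hmn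
  obtain ⟨k, hk⟩ := (h.add (level_modEq π t i)).sub (level_modEq τ t j)
  exact ⟨k, by linear_combination hk⟩

lemma eq_or_of_dvd (hm : 0 < m) {i j : Fin (m + n + 1)} (h : (m + n : ℤ) ∣ (i : ℕ) - (j : ℕ)) :
    i = j ∨ (i = 0 ∧ j = Fin.last _) ∨ (i = Fin.last _ ∧ j = 0) := by
  have hi := i.is_le
  have hj := j.is_le
  simp only [Fin.ext_iff, Fin.val_zero, Fin.val_last]
  obtain ⟨k, hk⟩ := h
  have h1 : k ≤ 1 := by
    by_contra hc
    nlinarith [show (2 : ℤ) ≤ k by omega]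
  have h2 : -1 ≤ k := by
    by_contra hc
    nlinarith [show k ≤ -2 by omega]
  obtain rfl | rfl | rfl : k = -1 ∨ k = 0 ∨ k = 1 := by omega
  all_goals omega

lemma level_eq_of_dvd (hm : 0 < m) (hmn : Nat.Coprime m n) {i j : Fin (m + n + 1)}
    (h : (m + n : ℤ) ∣ level π t i - level π t j) : level π t i = level π t j := by
  rcases eq_or_of_dvd hm (dvd_sub_of_level π t hmn π h) with h | ⟨h, h'⟩ | ⟨h, h'⟩
  · rw [h]
  · rw [h, h', level_zero, level_last]
  · rw [h, h', level_zero, level_last]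

/-- As `m` is invertible modulo `m + n`, the times `0, …, m + n - 1` run through all residues. -/
lemma exists_level_modEq (hm : 0 < m) (hmn : Nat.Coprime m n) (e : ℤ) :
    ∃ i : Fin (m + n), (m + n : ℤ) ∣ e - level π t i.castSucc := by
  have hc : IsCoprime (m : ℤ) (m + n) := by
    have : IsCoprime (m : ℤ) n := Nat.isCoprime_iff_coprime.2 hmn
    simpa [add_comm] using IsCoprime.add_mul_left_right this 1
  obtain ⟨u, v, huv⟩ := hc
  have h0 := Int.emod_nonneg ((e - t) * u) (b := m + n) (by omega)
  have h1 := Int.emod_lt_of_pos ((e - t) * u) (b := m + n) (by omega)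
  have h2 := Int.mul_ediv_add_emod ((e - t) * u) (m + n)
  set r := ((e - t) * u) % (m + n)
  set d := ((e - t) * u) / (m + n)
  refine ⟨⟨r.toNat, by omega⟩, ?_⟩
  have h3 := level_modEq π t (Fin.castSucc ⟨r.toNat, by omega⟩)
  rw [Fin.val_castSucc, Int.toNat_of_nonneg h0] at h3
  have : (m + n : ℤ) ∣ e - (t + m * r) :=
    ⟨d * m + v * (e - t), by linear_combination (-(m : ℤ)) * h2 - (e - t) * huv⟩
  obtain ⟨k, hk⟩ := this.add h3
  exact ⟨k, by linear_combination hk⟩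

/-- The path is closed in level, so starting points of steps may be counted in place of end points.
-/
lemma pathProfile_eq_castSucc (e : ℤ) :
    pathProfile π t e = ∑ i : Fin (m + n), levelCount m n (level π t i.castSucc) e := by
  have h1 := Fin.sum_univ_succ fun i => levelCount m n (level π t i) e
  have h2 := Fin.sum_univ_castSucc fun i => levelCount m n (level π t i) e
  rw [level_zero] at h1
  rw [level_last] at h2
  unfold pathProfile
  omega

/-- The number of up-steps ending in level `e`. -/
def upCount (e : ℤ) : ℕ :=
  ∑ i : Fin (m + n), (if (π.pt i.succ).1 = (π.pt i.castSucc).1 then 1 else 0) *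
    (if level π t i.succ = e then 1 else 0)

/-- The number of right-steps ending in level `e`. -/
def rightCount (e : ℤ) : ℕ :=
  ∑ i : Fin (m + n), (if (π.pt i.succ).2 = (π.pt i.castSucc).2 then 1 else 0) *
    (if level π t i.succ = e then 1 else 0)

/-- With one sum taken over starts and the other over ends, both laws hold step by step. An up-step
starts `m` below its end and a right-step `n` above it. -/
lemma isProfile_path (hm : 0 < m) :
    IsProfile m n (upCount π t) (rightCount π t) (pathProfile π t) where
  low := ⟨t, fun e he => Finset.sum_eq_zero fun i _ =>
    levelCount_eq_zero (he.trans_le (le_level π t _))⟩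
  up e := by
    rw [pathProfile_eq_castSucc π t (e - m), upCount, pathProfile, ← Finset.sum_add_distrib]
    refine Finset.sum_congr rfl fun i _ => ?_
    rcases level_step π t i with ⟨h1, -, h⟩ | ⟨h1, -, h⟩
    · rw [if_pos h1, one_mul, levelCount_sub_period hm, h,
        ← levelCount_add (level π t i.castSucc) (e - m) m, sub_add_cancel]
    · rw [if_neg h1, h, zero_mul, zero_add, ← levelCount_add _ _ (n : ℤ), sub_add_cancel]
      congr 1
      ring
  down e := by
    rw [pathProfile_eq_castSucc π t (e - m), rightCount, pathProfile, ← Finset.sum_add_distrib]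
    refine Finset.sum_congr rfl fun i _ => ?_
    rcases level_step π t i with ⟨-, h1, h⟩ | ⟨-, h1, h⟩
    · rw [if_neg h1, h, zero_mul, zero_add, ← levelCount_add _ _ (m : ℤ), sub_add_cancel]
    · rw [if_pos h1, one_mul, ← levelCount_sub_period hm (level π t i.succ) e]
      congr 1
      rw [h, ← levelCount_add _ (e - (m + n)) (n : ℤ), sub_add_cancel]
      congr 1
      ring

lemma pathProfile_pos_iff (hm : 0 < m) {e : ℤ} : 0 < pathProfile π t e ↔
    ∃ i, level π t i ≤ e ∧ (m + n : ℤ) ∣ e - level π t i := by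
  have key : ∀ v, 0 < levelCount m n v e ↔ v ≤ e ∧ (m + n : ℤ) ∣ e - v := by
    intro v
    unfold levelCount
    split_ifs with h <;> simp [h]
  rw [pathProfile, Finset.sum_pos_iff]
  simp only [Finset.mem_univ, true_and, key]
  constructor
  · rintro ⟨i, hi⟩
    exact ⟨_, hi⟩
  · rintro ⟨i, hi⟩
    induction i using Fin.cases with
    | succ i => exact ⟨i, hi⟩
    -- The sum runs over ends of steps, so the initial point is replaced by the final one, which has
    -- the same level.
    | zero =>
      refine ⟨⟨m + n - 1, by omega⟩, ?_⟩
      have : (⟨m + n - 1, by omega⟩ : Fin (m + n)).succ = Fin.last _ := by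
        simp only [Fin.ext_iff, Fin.val_succ, Fin.val_last]
        omega
      rwa [this, level_last, ← level_zero π t]

/-- The ends of distinct steps have distinct residues, so at most one of them is counted at `e`. -/
lemma pathProfile_le_one (hm : 0 < m) (hmn : Nat.Coprime m n) (e : ℤ) : pathProfile π t e ≤ 1 := by
  by_cases h : ∃ i : Fin (m + n), levelCount m n (level π t i.succ) e ≠ 0
  · obtain ⟨i, hi⟩ := h
    unfold pathProfile
    rw [Finset.sum_eq_single i]
    · exact levelCount_le_one _ _
    · intro j _ hji
      by_contra hj
      simp only [levelCount, ne_eq, ite_eq_right_iff, one_ne_zero, imp_false, not_not] at hi hj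
      have hd : (m + n : ℤ) ∣ level π t i.succ - level π t j.succ := by
        obtain ⟨k, hk⟩ := hj.2.sub hi.2
        exact ⟨k, by linear_combination hk⟩
      rcases eq_or_of_dvd hm (dvd_sub_of_level π t hmn π hd) with h | ⟨h, -⟩ | ⟨-, h⟩
      · exact hji (Fin.succ_injective _ h).symm
      · exact Fin.succ_ne_zero _ h
      · exact Fin.succ_ne_zero _ h
    · simp
  · push Not at h
    unfold pathProfile
    rw [Finset.sum_eq_zero fun i _ => h i]
    exact Nat.zero_le _

end paths

/-! ### Rooted paths as sets closed under adding `m` and `n` -/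

/-- A rooted path is determined by its profile. -/
lemma pathProfile_injective {m n : ℕ} (hm : 0 < m) (hmn : Nat.Coprime m n) {π τ : DyckPath m n}
    {t r : ℤ} (h : pathProfile π t = pathProfile τ r) : π = τ ∧ t = r := by
  have key : ∀ (π τ : DyckPath m n) (t r : ℤ), pathProfile π t = pathProfile τ r →
      ∀ i, ∃ j, level τ r j ≤ level π t i ∧ (m + n : ℤ) ∣ level π t i - level τ r j := by
    intro π τ t r h i
    rw [← pathProfile_pos_iff τ r hm, ← h, pathProfile_pos_iff π t hm]
    exact ⟨i, le_rfl, by simp⟩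
  have root : ∀ (π τ : DyckPath m n) (t r : ℤ), pathProfile π t = pathProfile τ r → r ≤ t := by
    intro π τ t r h
    obtain ⟨j, hj, -⟩ := key π τ t r h 0
    rw [level_zero] at hj
    exact (le_level τ r j).trans hj
  obtain rfl : t = r := le_antisymm (root τ π r t h.symm) (root π τ t r h)
  -- Congruent levels occur at the same time, so the two paths can be compared point by point.
  have le : ∀ (π τ : DyckPath m n), pathProfile π t = pathProfile τ t →
      ∀ i, level τ t i ≤ level π t i := by
    intro π τ h i
    obtain ⟨j, hj, hd⟩ := key π τ t t h i
    rcases eq_or_of_dvd hm (dvd_sub_of_level π t hmn τ hd) with h | ⟨h, h'⟩ | ⟨h, h'⟩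
    · rwa [h] at hj ⊢
    · rw [h, level_zero, level_zero]
    · rw [h, level_last, level_last]
  refine ⟨?_, rfl⟩
  ext i : 2
  have h1 := le_antisymm (le π τ h i) (le τ π h.symm i)
  have h2 := pt_add π i
  have h3 := pt_add τ i
  have h2' : ((π.pt i).1 : ℤ) = (i : ℕ) - (π.pt i).2 := by omega
  have h3' : ((τ.pt i).1 : ℤ) = (i : ℕ) - (τ.pt i).2 := by omega
  unfold level at h1
  rw [h2', h3'] at h1
  have h4 : (m + n : ℤ) * ((τ.pt i).2 - (π.pt i).2) = 0 := by linear_combination h1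
  have h5 : ((τ.pt i).2 - (π.pt i).2 : ℤ) = 0 :=
    (mul_eq_zero.1 h4).resolve_left (by omega)
  exact Prod.ext (by omega) (by omega)

/-- The greedy walk inside `U`: go right whenever the result lies in `U`, and up otherwise. -/
noncomputable def greedyWalk (m n : ℕ) (U : Set ℤ) (t : ℤ) : ℕ → ℕ × ℕ
  | 0 => (0, 0)
  | i + 1 =>
    haveI := Classical.dec
      (t + m * (greedyWalk m n U t i).2 - n * (greedyWalk m n U t i).1 - n ∈ U)
    if t + m * (greedyWalk m n U t i).2 - n * (greedyWalk m n U t i).1 - n ∈ U then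
      ((greedyWalk m n U t i).1 + 1, (greedyWalk m n U t i).2)
    else ((greedyWalk m n U t i).1, (greedyWalk m n U t i).2 + 1)

lemma greedyWalk_step (m n : ℕ) (U : Set ℤ) (t : ℤ) (i : ℕ) :
    (t + m * (greedyWalk m n U t i).2 - n * (greedyWalk m n U t i).1 - n ∈ U ∧
      greedyWalk m n U t (i + 1) = ((greedyWalk m n U t i).1 + 1, (greedyWalk m n U t i).2)) ∨
    (t + m * (greedyWalk m n U t i).2 - n * (greedyWalk m n U t i).1 - n ∉ U ∧
      greedyWalk m n U t (i + 1) = ((greedyWalk m n U t i).1, (greedyWalk m n U t i).2 + 1)) := by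
  rw [greedyWalk]
  split_ifs with h
  · exact Or.inl ⟨h, rfl⟩
  · exact Or.inr ⟨h, rfl⟩

/-- Every non-empty set of integers that is bounded below and closed under adding `m` and `n` is
the support of the profile of a rooted path. -/
lemma exists_path_of_set {m n : ℕ} (hm : 0 < m) (hmn : Nat.Coprime m n) (U : Set ℤ)
    (hne : U.Nonempty) (hbdd : BddBelow U) (hUm : ∀ e ∈ U, e + m ∈ U) (hUn : ∀ e ∈ U, e + n ∈ U) :
    ∃ (π : DyckPath m n) (t : ℤ), ∀ e, 0 < pathProfile π t e ↔ e ∈ U := by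
  obtain ⟨t, htU, ht⟩ : ∃ t ∈ U, ∀ e ∈ U, t ≤ e := by
    obtain ⟨B, hB⟩ := hbdd
    obtain ⟨x, hx⟩ := hne
    obtain ⟨t, h1, h2⟩ := Int.exists_least_of_bdd (P := (· ∈ U)) ⟨B, fun z hz => hB hz⟩ ⟨x, hx⟩
    exact ⟨t, h1, h2⟩
  set w := greedyWalk m n U t with hw
  set v : ℕ → ℤ := fun i => t + m * (w i).2 - n * (w i).1 with hv
  have period : ∀ e ∈ U, e + (m + n) ∈ U := fun e he => by
    rw [← add_assoc]
    exact hUn _ (hUm _ he)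
  have periods : ∀ e ∈ U, ∀ k : ℕ, e + (m + n) * k ∈ U := by
    intro e he k
    induction k with
    | zero => simpa using he
    | succ k ih =>
      convert period _ ih using 1
      push_cast
      ring
  have sum : ∀ i, (w i).1 + (w i).2 = i := by
    intro i
    induction i with
    | zero => rfl
    | succ i ih =>
      rcases greedyWalk_step m n U t i with ⟨-, h⟩ | ⟨-, h⟩ <;> rw [← hw] at h <;> rw [h] <;>
        dsimp only <;> omega
  -- The walk stays at the least element of `U` in its residue class. An up-step to `v i + m` is
  -- taken only when `v i - n = (v i + m) - (m + n)` is outside `U`.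
  have inv : ∀ i, v i ∈ U ∧ v i - (m + n) ∉ U := by
    intro i
    induction i with
    | zero =>
      have : v 0 = t := by simp [hv, hw, greedyWalk]
      rw [this]
      exact ⟨htU, fun h => absurd (ht _ h) (by omega)⟩
    | succ i ih =>
      rcases greedyWalk_step m n U t i with ⟨hU, h⟩ | ⟨hU, h⟩
      · have : v (i + 1) = v i - n := by
          simp only [hv, hw, h]
          push_cast
          ring
        rw [this]
        refine ⟨hU, fun hc => ih.2 ?_⟩
        convert hUn _ hc using 1
        ring
      · have : v (i + 1) = v i + m := by
          simp only [hv, hw, h]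
          push_cast
          ring
        rw [this]
        refine ⟨hUm _ ih.1, fun hc => hU ?_⟩
        convert hc using 1
        simp only [hv]
        ring
  have minimal : ∀ i, ∀ e ∈ U, (m + n : ℤ) ∣ e - v i → v i ≤ e := by
    intro i e he hd
    by_contra hlt
    obtain ⟨k, hk⟩ := hd
    have hk0 : k < 0 := by
      by_contra hk0
      nlinarith [show (0 : ℤ) ≤ (m + n) * k from mul_nonneg (by omega) (by omega)]
    apply (inv i).2
    convert periods e he (-1 - k).toNat using 1
    rw [Int.toNat_of_nonneg (by omega)]
    linear_combination (-1 : ℤ) * hk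
  -- After `m + n` steps the residue is that of `t`, the least element of `U`, so the walk is back
  -- at level `t`.
  have finish : w (m + n) = (m, n) := by
    have h1 := sum (m + n)
    have h1' : ((w (m + n)).1 : ℤ) = m + n - (w (m + n)).2 := by omega
    have h2 : v (m + n) = t := by
      refine le_antisymm (minimal _ _ htU ?_) (ht _ (inv _).1)
      refine ⟨n - (w (m + n)).2, ?_⟩
      simp only [hv, h1']
      ring
    have h3 : (m + n : ℤ) * ((w (m + n)).2 - n) = 0 := by
      simp only [hv, h1'] at h2
      linear_combination h2
    have h4 := (mul_eq_zero.1 h3).resolve_left (by omega)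
    exact Prod.ext (by dsimp only; omega) (by dsimp only; omega)
  let π : DyckPath m n :=
    { pt := fun i => w i
      start := rfl
      finish := finish
      step := fun i => by
        rcases greedyWalk_step m n U t i with ⟨-, h⟩ | ⟨-, h⟩
        · exact Or.inl h
        · exact Or.inr h
      above := fun i => by
        have := ht _ (inv i).1
        simp only [hv] at this
        zify
        omega }
  have hl : ∀ i, level π t i = v i := fun _ => rfl
  refine ⟨π, t, fun e => ?_⟩
  rw [pathProfile_pos_iff π t hm]
  constructor
  · rintro ⟨i, hi, k, hk⟩
    rw [hl] at hi hk
    have : 0 ≤ k := by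
      by_contra hc
      nlinarith
    convert periods _ (inv i).1 k.toNat using 1
    rw [Int.toNat_of_nonneg this]
    linear_combination hk
  · intro he
    obtain ⟨i, hi⟩ := exists_level_modEq π t hm hmn e
    exact ⟨i.castSucc, minimal _ e he hi, hi⟩

end ShiftEq

namespace ShiftEq

/-! ### Nested lists of indicator functions -/

section lists

variable {ι : Type*} {f : ι → ℤ → ℕ}

/-- In a nested list the head is the indicator of the support of the sum, so heads agree and can be
removed. -/
lemma list_eq_of_sum_eq (hinj : Function.Injective f) (hone : ∀ a e, f a e ≤ 1)
    (hpos : ∀ a, ∃ e, 0 < f a e) {L L' : List ι}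
    (hL : L.Pairwise fun a b => ∀ e, f b e ≤ f a e)
    (hL' : L'.Pairwise fun a b => ∀ e, f b e ≤ f a e)
    (h : ∀ e, (L.map (f · e)).sum = (L'.map (f · e)).sum) : L = L' := by
  have key : ∀ (a : ι) (L : List ι), (∀ b ∈ L, ∀ e, f b e ≤ f a e) →
      ∀ e, 0 < ((a :: L).map (f · e)).sum ↔ 0 < f a e := by
    intro a L hL e
    rw [List.map_cons, List.sum_cons]
    refine ⟨fun h => ?_, fun h => by omega⟩
    by_contra h0
    have : (L.map (f · e)).sum = 0 := List.sum_eq_zero fun x hx => by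
      obtain ⟨b, hb, rfl⟩ := List.mem_map.1 hx
      have := hL b hb e
      omega
    omega
  induction L generalizing L' with
  | nil =>
    cases L' with
    | nil => rfl
    | cons a' L' =>
      obtain ⟨e, he⟩ := hpos a'
      have := h e
      simp only [List.map_nil, List.sum_nil, List.map_cons, List.sum_cons] at this
      omega
  | cons a L ih =>
    cases L' with
    | nil =>
      obtain ⟨e, he⟩ := hpos a
      have := h e
      simp only [List.map_nil, List.sum_nil, List.map_cons, List.sum_cons] at this
      omega
    | cons a' L' =>
      rw [List.pairwise_cons] at hL hL'
      have ha : f a = f a' := by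
        funext e
        have h1 := key a L hL.1 e
        have h2 := key a' L' hL'.1 e
        rw [h e, h2] at h1
        have := hone a e
        have := hone a' e
        omega
      obtain rfl := hinj ha
      congr 1
      refine ih hL.2 hL'.2 fun e => ?_
      have := h e
      simp only [List.map_cons, List.sum_cons] at this
      omega

/-- Layer-cake decomposition. The length is the maximum of `C`, attained at `e₀`, so every layer is
non-empty. -/
lemma exists_list_sum_eq (hone : ∀ a e, f a e ≤ 1) {C : ℤ → ℕ} (hC : ∃ K, ∀ e, C e ≤ K)
    (hsurj : ∀ i, (∃ e, i < C e) → ∃ a, ∀ e, 0 < f a e ↔ i < C e) :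
    ∃ L : List ι, (L.Pairwise fun a b => ∀ e, f b e ≤ f a e) ∧
      ∀ e, (L.map (f · e)).sum = C e := by
  obtain ⟨e₀, he₀⟩ : ∃ e₀, ∀ e, C e ≤ C e₀ := by
    have hb : BddAbove (Set.range C) := by
      obtain ⟨K, hK⟩ := hC
      exact ⟨K, by rintro _ ⟨e, rfl⟩; exact hK e⟩
    obtain ⟨e₀, he₀⟩ := Nat.sSup_mem (Set.range_nonempty C) hb
    exact ⟨e₀, fun e => he₀ ▸ le_csSup hb ⟨e, rfl⟩⟩
  choose g hg using fun i : Fin (C e₀) => hsurj i ⟨e₀, i.2⟩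
  have hval : ∀ i e, f (g i) e = if (i : ℕ) < C e then 1 else 0 := by
    intro i e
    have := hg i e
    have := hone (g i) e
    split_ifs <;> omega
  refine ⟨List.ofFn g, List.pairwise_ofFn.2 fun i j hij e => ?_, fun e => ?_⟩
  · rw [hval, hval]
    have : (i : ℕ) < j := hij
    split_ifs <;> omega
  · rw [List.map_ofFn, List.sum_ofFn]
    simp only [Function.comp_apply, hval]
    rw [Fin.sum_univ_eq_sum_range (fun i => if i < C e then 1 else 0), Finset.sum_boole]
    have : (Finset.range (C e₀)).filter (· < C e) = Finset.range (C e) := by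
      ext i
      have := he₀ e
      simp only [Finset.mem_filter, Finset.mem_range]
      omega
    rw [this]
    simp

end lists

/-! ### The order -/

/-- Coprimality makes `(m, n)` generate the kernel of the level map, so the level is a coordinate on
the cylinder. -/
lemma cylinder_mk_eq_iff {m n : ℕ} (hm : 0 < m) (hmn : Nat.Coprime m n) {x y x' y' : ℤ} :
    (QuotientAddGroup.mk (x, y) : Cylinder m n) = QuotientAddGroup.mk (x', y') ↔
      (m : ℤ) * y - n * x = m * y' - n * x' := by
  rw [QuotientAddGroup.eq, AddSubgroup.mem_zmultiples_iff]
  simp only [Prod.smul_mk, smul_eq_mul, Prod.neg_mk, Prod.mk_add_mk, Prod.mk.injEq]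
  constructor
  · rintro ⟨j, h1, h2⟩
    linear_combination (m : ℤ) * h2 - (n : ℤ) * h1
  · intro h
    have hd : (m : ℤ) ∣ -x + x' := by
      refine IsCoprime.dvd_of_dvd_mul_left (Nat.isCoprime_iff_coprime.2 hmn) ⟨-y + y', ?_⟩
      linear_combination h
    obtain ⟨j, hj⟩ := hd
    refine ⟨j, by rw [hj, mul_comm], ?_⟩
    have hm' : (m : ℤ) ≠ 0 := by omega
    apply mul_left_cancel₀ hm'
    linear_combination h - (n : ℤ) * hj

lemma mk_mem_range_cylSeq {m n : ℕ} (hm : 0 < m) (hmn : Nat.Coprime m n) (π : DyckPath m n)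
    (k l x y : ℤ) : (QuotientAddGroup.mk (x, y) : Cylinder m n) ∈ Set.range (cylSeq π k l) ↔
      ∃ i, level π (m * l - n * k) i = m * y - n * x := by
  simp only [Set.mem_range, cylSeq, cylinder_mk_eq_iff hm hmn, level]
  refine exists_congr fun i => ?_
  constructor <;> intro h <;> linear_combination h

/-- For points with equal `x + y`, the levels differ by `(m + n) (y' - y)`. South-east thus means
lower in each residue class, that is, larger support. -/
lemma cylSeq_southEast_iff {m n : ℕ} (hm : 0 < m) (hmn : Nat.Coprime m n)
    {γ δ : CylDyckPath m n} {π τ : DyckPath m n} {k l k' l' : ℤ}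
    (hγ : γ.1 = cylSeq π k l) (hδ : δ.1 = cylSeq τ k' l') :
    γ.SouthEast δ ↔ ∀ e, pathProfile τ (m * l' - n * k') e ≤ pathProfile π (m * l - n * k) e := by
  unfold CylDyckPath.SouthEast
  rw [hγ, hδ]
  simp only [mk_mem_range_cylSeq hm hmn]
  set t : ℤ := m * l - n * k with ht
  set r : ℤ := m * l' - n * k' with hr
  constructor
  · intro H e
    by_cases h0 : 0 < pathProfile τ r e
    · refine (pathProfile_le_one τ r hm hmn e).trans (?_ : 0 < pathProfile π t e)
      rw [pathProfile_pos_iff _ _ hm] at h0 ⊢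
      obtain ⟨j, hj, hd⟩ := h0
      obtain ⟨i, hi⟩ := exists_level_modEq π t hm hmn e
      -- Congruent levels have congruent `x + y`; moving the lift of the point of `τ` by `d (m, n)`
      -- makes these sums equal.
      obtain ⟨d, hd'⟩ : (m + n : ℤ) ∣ (((π.pt i.castSucc).1 + k) + ((π.pt i.castSucc).2 + l)) -
          (((τ.pt j).1 + k') + ((τ.pt j).2 + l')) := by
        apply dvd_index_sub hmn
        obtain ⟨u, hu⟩ := hd
        obtain ⟨v, hv⟩ := hi
        unfold level at hu hv
        refine ⟨u - v + ((π.pt i.castSucc).1 + k) - ((τ.pt j).1 + k'), ?_⟩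
        linear_combination hu - hv + ht - hr
      have := H ((π.pt i.castSucc).1 + k) ((π.pt i.castSucc).2 + l)
        ((τ.pt j).1 + k' + m * d) ((τ.pt j).2 + l' + n * d)
        ⟨i.castSucc, by unfold level; linear_combination ht⟩
        ⟨j, by unfold level; linear_combination hr⟩
        (by linear_combination hd')
      refine ⟨i.castSucc, le_trans ?_ hj, hi⟩
      have hy : (0 : ℤ) ≤ ((τ.pt j).2 + l' + n * d) - ((π.pt i.castSucc).2 + l) := by linarith
      have := mul_nonneg (show (0 : ℤ) ≤ m + n by omega) hy
      have e1 : level τ r j - level π t i.castSucc =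
          (m + n) * (((τ.pt j).2 + l' + n * d) - ((π.pt i.castSucc).2 + l)) := by
        unfold level
        linear_combination hr - ht + (n : ℤ) * hd'
      linarith
    · omega
  · rintro H x y x' y' ⟨i, hi⟩ ⟨j, hj⟩ hsum
    have h1 := H (level τ r j)
    have h2 : 0 < pathProfile τ r (level τ r j) :=
      (pathProfile_pos_iff τ r hm).2 ⟨j, le_rfl, by simp⟩
    obtain ⟨i', hi', hd⟩ := (pathProfile_pos_iff π t hm).1 (h2.trans_le h1)
    have e1 : level τ r j - level π t i = (m + n) * (y' - y) := by
      rw [hi, hj]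
      linear_combination (n : ℤ) * hsum
    have e2 : level π t i = level π t i' := by
      refine level_eq_of_dvd π t hm hmn ?_
      obtain ⟨u, hu⟩ := hd
      exact ⟨u - (y' - y), by linear_combination hu - e1⟩
    have : 0 ≤ y' - y := by
      refine nonneg_of_mul_nonneg_right (a := (m + n : ℤ)) ?_ (by omega)
      rw [← e1, e2]
      omega
    omega

/-! ### Levels as points of the coset -/

/-- The point of level `e` in the coset of `z₀`. -/
noncomputable def node (α : ℂ) (n : ℕ) (z₀ : ℂ) (e : ℤ) : ℂ := z₀ - e * (α / n)

section node

variable {α β : ℂ} {m n : ℕ} {z₀ : ℂ}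

lemma node_injective (hα : α ≠ 0) (hn : 0 < n) : Function.Injective (node α n z₀) := by
  intro e e' h
  have hs : α / n ≠ 0 := div_ne_zero hα (by exact_mod_cast hn.ne')
  have : (e : ℂ) = e' := by
    apply mul_right_cancel₀ hs
    unfold node at h
    linear_combination -h
  exact_mod_cast this

lemma node_add (hn : 0 < n) (h : (m : ℂ) * α + (n : ℂ) * β = 0) (e x y : ℤ) :
    node α n z₀ e + x * α + y * β = node α n z₀ (e + m * y - n * x) := by
  have hn' : (n : ℂ) ≠ 0 := by exact_mod_cast hn.ne'
  unfold node
  field_simp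
  push_cast
  linear_combination (y : ℂ) * h

lemma mk_node (hn : 0 < n) (hmn : Nat.Coprime m n) (h : (m : ℂ) * α + (n : ℂ) * β = 0) (e : ℤ) :
    (node α n z₀ e : ℂ ⧸ latticeGroup α β) = z₀ := by
  obtain ⟨u, v, huv⟩ := Nat.isCoprime_iff_coprime.2 hmn
  have h1 := node_add (z₀ := z₀) hn h e (e * v) (-(e * u))
  rw [show e + m * (-(e * u)) - n * (e * v) = 0 by linear_combination (-e) * huv,
    show node α n z₀ 0 = z₀ by simp [node]] at h1
  rw [QuotientAddGroup.eq]
  refine AddSubgroup.mem_sup.2 ⟨(e * v : ℤ) • α, ⟨_, rfl⟩, (-(e * u) : ℤ) • β, ⟨_, rfl⟩, ?_⟩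
  rw [zsmul_eq_mul, zsmul_eq_mul]
  push_cast at h1 ⊢
  linear_combination h1

lemma exists_node (hn : 0 < n) (h : (m : ℂ) * α + (n : ℂ) * β = 0) {z : ℂ}
    (hz : (z : ℂ ⧸ latticeGroup α β) = z₀) : ∃ e, z = node α n z₀ e := by
  have hmem : -z₀ + z ∈ latticeGroup α β := QuotientAddGroup.eq.1 hz.symm
  obtain ⟨_, ⟨k, rfl⟩, _, ⟨l, rfl⟩, hkl⟩ := AddSubgroup.mem_sup.1 hmem
  simp only [zsmul_eq_mul] at hkl
  refine ⟨0 + m * l - n * k, ?_⟩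
  rw [← node_add hn h, node]
  push_cast
  linear_combination -hkl

end node

/-- The root level is `m l - n k` for any way of writing the point as `z₀ + k α + l β`, so the
normalization of `k` does not affect the order. -/
lemma southEast_iff {α β : ℂ} {m n : ℕ} {z₀ : ℂ} {c : ℂ ⧸ latticeGroup α β} (hα : α ≠ 0)
    (hβ : β ≠ 0) (hm : 0 < m) (hn : 0 < n) (hmn : Nat.Coprime m n)
    (h : (m : ℂ) * α + (n : ℂ) * β = 0) (hz₀ : (z₀ : ℂ ⧸ latticeGroup α β) = c)
    {a b : PathIn m n c} {t r : ℤ} (ht : (a.2 : ℂ) = node α n z₀ t)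
    (hr : (b.2 : ℂ) = node α n z₀ r) :
    SouthEast z₀ a b ↔ ∀ e, pathProfile b.1 r e ≤ pathProfile a.1 t e := by
  have root : ∀ {z : ℂ} {t k l : ℤ}, z = node α n z₀ t → z = z₀ + (k : ℂ) * α + (l : ℂ) * β →
      t = m * l - n * k := by
    intro z t k l h1 h2
    apply node_injective (z₀ := z₀) hα hn
    rw [← h1, h2, ← zero_add ((m : ℤ) * l), ← node_add hn h]
    simp [node]
  constructor
  · rintro ⟨γ, δ, ⟨k, l, -, -, h1, h2⟩, ⟨k', l', -, -, h1', h2'⟩, hse⟩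
    rw [root ht h1, root hr h1']
    exact (cylSeq_southEast_iff hm hmn h2 h2').1 hse
  · intro H
    obtain ⟨γ, hγ, -⟩ := existsUnique_correspondsTo hβ hm hmn h z₀ hz₀ a
    obtain ⟨δ, hδ, -⟩ := existsUnique_correspondsTo hβ hm hmn h z₀ hz₀ b
    refine ⟨γ, δ, hγ, hδ, ?_⟩
    obtain ⟨k, l, -, -, h1, h2⟩ := hγ
    obtain ⟨k', l', -, -, h1', h2'⟩ := hδ
    rw [root ht h1, root hr h1'] at H
    exact (cylSeq_southEast_iff hm hmn h2 h2').2 H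

end ShiftEq

namespace ShiftEq

/-! ### Root multiplicities of solutions -/

lemma rootMultiplicity_comp_X_add_C (p : ℂ[X]) (b z : ℂ) :
    (p.comp (X + C b)).rootMultiplicity z = p.rootMultiplicity (z + b) := by
  rw [rootMultiplicity_eq_rootMultiplicity, rootMultiplicity_eq_rootMultiplicity (p := p),
    comp_assoc]
  simp [add_assoc]

lemma comp_X_add_C_ne_zero {p : ℂ[X]} (hp : p ≠ 0) (b : ℂ) : p.comp (X + C b) ≠ 0 := by
  rwa [Ne, comp_X_add_C_eq_zero_iff]

lemma eq_of_rootMultiplicity_eq {p q : ℂ[X]} (hp : p.Monic) (hq : q.Monic)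
    (h : ∀ z, p.rootMultiplicity z = q.rootMultiplicity z) : p = q := by
  have : p.roots = q.roots := by
    ext z
    rw [count_roots, count_roots, h]
  rw [(IsAlgClosed.splits p).eq_prod_roots_of_monic hp,
    (IsAlgClosed.splits q).eq_prod_roots_of_monic hq, this]

lemma rootMultiplicity_prod_X_sub_C {ι : Type*} (s : Finset ι) (f : ι → ℂ) (k : ι → ℕ) (z : ℂ) :
    (∏ i ∈ s, (X - C (f i)) ^ k i).rootMultiplicity z =
      ∑ i ∈ s, k i * if f i = z then 1 else 0 := by
  classical
  have hne : ∏ i ∈ s, (X - C (f i)) ^ k i ≠ 0 :=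
    Finset.prod_ne_zero_iff.2 fun i _ => pow_ne_zero _ (X_sub_C_ne_zero _)
  rw [← count_roots, roots_prod _ _ hne, Multiset.count_bind, Finset.sum]
  congr 1
  refine Multiset.map_congr rfl fun i _ => ?_
  rw [roots_pow, roots_X_sub_C, Multiset.count_nsmul, Multiset.count_singleton]
  simp [eq_comm]

section solutions

variable {α β : ℂ} {m n : ℕ} {z₀ : ℂ}

lemma IsSolution.mul {A B : ℂ[X] × ℂ[X]} (hA : IsSolution α β A) (hB : IsSolution α β B) :
    IsSolution α β (A * B) := by
  unfold IsSolution at *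
  simp only [Prod.fst_mul, Prod.snd_mul, mul_comp]
  linear_combination B.1 * B.2 * hA + A.1.comp (X + C β) * A.2.comp (X + C α) * hB

/-- Comparing root multiplicities in the equation gives conservation of flow. Monicity is not
assumed, so this covers the arbitrary factors in the definition of irreducibility. -/
lemma IsSolution.exists_isProfile (hα : α ≠ 0) (hm : 0 < m) (hn : 0 < n)
    (h : (m : ℂ) * α + (n : ℂ) * β = 0) {P : ℂ[X] × ℂ[X]} (hP : IsSolution α β P)
    (h1 : P.1 ≠ 0) (h2 : P.2 ≠ 0) (z₀ : ℂ) :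
    ∃ C, IsProfile m n (fun e => P.1.rootMultiplicity (node α n z₀ e))
      (fun e => P.2.rootMultiplicity (node α n z₀ e)) C ∧ ∃ K, ∀ e, C e ≤ K := by
  have h12 : P.1 * P.2 ≠ 0 := mul_ne_zero h1 h2
  have hfin : {e | (P.1 * P.2).IsRoot (node α n z₀ e)}.Finite :=
    (finite_setOfPred_isRoot h12).preimage (node_injective hα hn).injOn
  refine ShiftEq.exists_isProfile hm hfin.toFinset (fun e he => ?_) fun e => ?_
  · rw [Set.Finite.mem_toFinset, Set.mem_ofPred_eq] at he
    rw [← rootMultiplicity_mul h12]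
    exact rootMultiplicity_eq_zero he
  · have hup : node α n z₀ e + β = node α n z₀ (e + m) := by
      simpa using node_add (z₀ := z₀) hn h e 0 1
    have hright : node α n z₀ e + α = node α n z₀ (e - n) := by
      simpa using node_add (z₀ := z₀) hn h e 1 0
    have hP' : P.1 * P.2 = P.1.comp (X + C β) * P.2.comp (X + C α) := hP
    rw [← rootMultiplicity_mul h12, hP', rootMultiplicity_mul
      (mul_ne_zero (comp_X_add_C_ne_zero h1 _) (comp_X_add_C_ne_zero h2 _)),
      rootMultiplicity_comp_X_add_C, rootMultiplicity_comp_X_add_C, hup, hright]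

lemma IsIntegralSolution.mul {c : ℂ ⧸ latticeGroup α β} {A B : ℂ[X] × ℂ[X]}
    (hA : IsIntegralSolution α β c A) (hB : IsIntegralSolution α β c B) :
    IsIntegralSolution α β c (A * B) := by
  refine ⟨⟨hA.1.1.mul hB.1.1, hA.1.2.1.mul hB.1.2.1, hA.1.2.2.mul hB.1.2.2⟩, fun z hz => ?_⟩
  have : (A.1 * A.2 * (B.1 * B.2)).IsRoot z := by
    convert hz using 1
    simp only [Prod.fst_mul, Prod.snd_mul]
    ring
  rcases root_mul.1 this with h | h
  · exact hA.2 z h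
  · exact hB.2 z h

lemma isIntegralSolution_one {c : ℂ ⧸ latticeGroup α β} : IsIntegralSolution α β c 1 :=
  ⟨⟨monic_one, monic_one, by simp [IsSolution]⟩, fun z hz => by simp at hz⟩

lemma isIntegralSolution_list_prod {c : ℂ ⧸ latticeGroup α β} {L : List (ℂ[X] × ℂ[X])}
    (hL : ∀ P ∈ L, IsIntegralSolution α β c P) : IsIntegralSolution α β c L.prod := by
  induction L with
  | nil => exact isIntegralSolution_one
  | cons P L ih =>
    rw [List.prod_cons]
    exact (hL P (by simp)).mul (ih fun Q hQ => hL Q (by simp [hQ]))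

lemma IsIntegralSolution.eq_of_rootMultiplicity_eq (hn : 0 < n)
    (h : (m : ℂ) * α + (n : ℂ) * β = 0) {A B : ℂ[X] × ℂ[X]}
    (hA : IsIntegralSolution α β z₀ A) (hB : IsIntegralSolution α β z₀ B)
    (h1 : ∀ e, A.1.rootMultiplicity (node α n z₀ e) = B.1.rootMultiplicity (node α n z₀ e))
    (h2 : ∀ e, A.2.rootMultiplicity (node α n z₀ e) = B.2.rootMultiplicity (node α n z₀ e)) :
    A = B := by
  have off : ∀ {P : ℂ[X] × ℂ[X]}, IsIntegralSolution α β z₀ P → ∀ {z : ℂ},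
      (z : ℂ ⧸ latticeGroup α β) ≠ z₀ → P.1.rootMultiplicity z = 0 ∧ P.2.rootMultiplicity z = 0 :=
    fun hP z hz => ⟨rootMultiplicity_eq_zero fun hr => hz (hP.2 z (root_mul.2 (Or.inl hr))),
      rootMultiplicity_eq_zero fun hr => hz (hP.2 z (root_mul.2 (Or.inr hr)))⟩
  refine Prod.ext (ShiftEq.eq_of_rootMultiplicity_eq hA.1.1 hB.1.1 fun z => ?_)
    (ShiftEq.eq_of_rootMultiplicity_eq hA.1.2.1 hB.1.2.1 fun z => ?_) <;>
  by_cases hz : (z : ℂ ⧸ latticeGroup α β) = z₀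
  · obtain ⟨e, rfl⟩ := exists_node hn h hz
    exact h1 e
  · rw [(off hA hz).1, (off hB hz).1]
  · obtain ⟨e, rfl⟩ := exists_node hn h hz
    exact h2 e
  · rw [(off hA hz).2, (off hB hz).2]

/-! ### The solutions attached to paths -/

lemma pathSolution_mul (π : DyckPath m n) (z : ℂ) :
    (pathSolution α β π z).1 * (pathSolution α β π z).2 =
      ∏ i : Fin (m + n), (X - C (z + (π.pt i.succ).1 * α + (π.pt i.succ).2 * β)) := by
  simp only [pathSolution]
  rw [← Finset.prod_mul_distrib]
  refine Finset.prod_congr rfl fun i _ => ?_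
  rw [← pow_add]
  rcases level_step π 0 i with ⟨h1, h2, -⟩ | ⟨h1, h2, -⟩
  · rw [if_pos h1, if_neg h2, add_zero, pow_one]
  · rw [if_neg h1, if_pos h2, zero_add, pow_one]

lemma isSolution_pathSolution (h : (m : ℂ) * α + (n : ℂ) * β = 0) (π : DyckPath m n) (z : ℂ) :
    IsSolution α β (pathSolution α β π z) := by
  set g : Fin (m + n + 1) → ℂ[X] := fun i => X - C (z + (π.pt i).1 * α + (π.pt i).2 * β) with hg
  -- The path closes up in `ℂ` because `m α + n β = 0`; the shifts in the equation carry the end of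
  -- each step to its start.
  have hcyc : ∏ i : Fin (m + n), g i.succ = ∏ i : Fin (m + n), g i.castSucc := by
    have h1 := Fin.prod_univ_succ g
    have h2 := Fin.prod_univ_castSucc g
    have h3 : g (Fin.last _) = g 0 := by
      simp only [hg, π.start, π.finish]
      rw [add_assoc, h]
      simp
    rw [h3, mul_comm] at h2
    exact mul_left_cancel₀ (X_sub_C_ne_zero _) (h1.symm.trans h2)
  unfold IsSolution
  rw [pathSolution_mul]
  refine hcyc.trans ?_
  simp only [pathSolution]
  rw [prod_comp, prod_comp, ← Finset.prod_mul_distrib]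
  refine Finset.prod_congr rfl fun i _ => ?_
  simp only [pow_comp, sub_comp, X_comp, C_comp, hg]
  rcases π.step i with hs | hs <;> rw [hs]
  · rw [if_neg (by simp), if_pos rfl, pow_zero, one_mul, pow_one]
    simp only [C_add, C_mul, Nat.cast_add, Nat.cast_one, C_1]
    ring
  · rw [if_pos rfl, if_neg (by simp), pow_zero, mul_one, pow_one]
    simp only [C_add, C_mul, Nat.cast_add, Nat.cast_one, C_1]
    ring

lemma node_level (hn : 0 < n) (h : (m : ℂ) * α + (n : ℂ) * β = 0) (π : DyckPath m n) (t : ℤ)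
    (i : Fin (m + n + 1)) : node α n z₀ t + (π.pt i).1 * α + (π.pt i).2 * β =
      node α n z₀ (level π t i) := by
  simpa [level] using node_add (z₀ := z₀) hn h t (π.pt i).1 (π.pt i).2

lemma isIntegralSolution_pathSolution (hn : 0 < n) (hmn : Nat.Coprime m n)
    (h : (m : ℂ) * α + (n : ℂ) * β = 0) (π : DyckPath m n) (t : ℤ) :
    IsIntegralSolution α β z₀ (pathSolution α β π (node α n z₀ t)) := by
  refine ⟨⟨?_, ?_, isSolution_pathSolution h π _⟩, fun z hz => ?_⟩
  · simp only [pathSolution]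
    exact monic_prod_of_monic Finset.univ _ fun i _ => (monic_X_sub_C _).pow _
  · simp only [pathSolution]
    exact monic_prod_of_monic Finset.univ _ fun i _ => (monic_X_sub_C _).pow _
  rw [pathSolution_mul, isRoot_prod] at hz
  obtain ⟨i, -, hi⟩ := hz
  rw [root_X_sub_C, node_level hn h] at hi
  rw [← hi]
  exact mk_node hn hmn h _

lemma rootMultiplicity_pathSolution_fst (hα : α ≠ 0) (hn : 0 < n)
    (h : (m : ℂ) * α + (n : ℂ) * β = 0) (π : DyckPath m n) (t e : ℤ) :
    (pathSolution α β π (node α n z₀ t)).1.rootMultiplicity (node α n z₀ e) = upCount π t e := by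
  simp only [pathSolution, node_level hn h]
  rw [rootMultiplicity_prod_X_sub_C]
  simp only [(node_injective hα hn).eq_iff]
  rfl

lemma rootMultiplicity_pathSolution_snd (hα : α ≠ 0) (hn : 0 < n)
    (h : (m : ℂ) * α + (n : ℂ) * β = 0) (π : DyckPath m n) (t e : ℤ) :
    (pathSolution α β π (node α n z₀ t)).2.rootMultiplicity (node α n z₀ e) =
      rightCount π t e := by
  simp only [pathSolution, node_level hn h]
  rw [rootMultiplicity_prod_X_sub_C]
  simp only [(node_injective hα hn).eq_iff]
  rfl

lemma isProfile_pathSolution (hα : α ≠ 0) (hm : 0 < m) (hn : 0 < n)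
    (h : (m : ℂ) * α + (n : ℂ) * β = 0) (π : DyckPath m n) (t : ℤ) :
    IsProfile m n
      (fun e => (pathSolution α β π (node α n z₀ t)).1.rootMultiplicity (node α n z₀ e))
      (fun e => (pathSolution α β π (node α n z₀ t)).2.rootMultiplicity (node α n z₀ e))
      (pathProfile π t) := by
  simp only [rootMultiplicity_pathSolution_fst hα hn h, rootMultiplicity_pathSolution_snd hα hn h]
  exact isProfile_path π t hm

lemma isProfile_rootMultiplicity_mul {A B : ℂ[X] × ℂ[X]} (h1 : A.1 * B.1 ≠ 0)
    (h2 : A.2 * B.2 ≠ 0) {CA CB : ℤ → ℕ}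
    (hA : IsProfile m n (fun e => A.1.rootMultiplicity (node α n z₀ e))
      (fun e => A.2.rootMultiplicity (node α n z₀ e)) CA)
    (hB : IsProfile m n (fun e => B.1.rootMultiplicity (node α n z₀ e))
      (fun e => B.2.rootMultiplicity (node α n z₀ e)) CB) :
    IsProfile m n (fun e => (A * B).1.rootMultiplicity (node α n z₀ e))
      (fun e => (A * B).2.rootMultiplicity (node α n z₀ e)) (fun e => CA e + CB e) := by
  simp only [Prod.fst_mul, Prod.snd_mul, rootMultiplicity_mul h1, rootMultiplicity_mul h2]
  exact hA.add hB

lemma isProfile_list_prod {c : ℂ ⧸ latticeGroup α β} {ι : Type*} {P : ι → ℂ[X] × ℂ[X]}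
    {f : ι → ℤ → ℕ} (hP : ∀ a, IsIntegralSolution α β c (P a))
    (hf : ∀ a, IsProfile m n (fun e => (P a).1.rootMultiplicity (node α n z₀ e))
      (fun e => (P a).2.rootMultiplicity (node α n z₀ e)) (f a)) (L : List ι) :
    IsProfile m n (fun e => (L.map P).prod.1.rootMultiplicity (node α n z₀ e))
      (fun e => (L.map P).prod.2.rootMultiplicity (node α n z₀ e))
      (fun e => (L.map (f · e)).sum) := by
  induction L with
  | nil =>
    have h0 : ∀ z : ℂ, (1 : ℂ[X]).rootMultiplicity z = 0 := fun z =>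
      rootMultiplicity_eq_zero (by simp)
    simpa [h0] using IsProfile.zero
  | cons a L ih =>
    simp only [List.map_cons, List.prod_cons, List.sum_cons]
    have hL : IsIntegralSolution α β c (L.map P).prod :=
      isIntegralSolution_list_prod fun Q hQ => by
      obtain ⟨b, -, rfl⟩ := List.mem_map.1 hQ
      exact hP b
    exact isProfile_rootMultiplicity_mul (mul_ne_zero (hP a).1.1.ne_zero hL.1.1.ne_zero)
      (mul_ne_zero (hP a).1.2.1.ne_zero hL.1.2.1.ne_zero) (hf a) ih

lemma isIrreducibleSolution_pathSolution (hα : α ≠ 0) (hm : 0 < m) (hn : 0 < n)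
    (hmn : Nat.Coprime m n) (h : (m : ℂ) * α + (n : ℂ) * β = 0) (π : DyckPath m n) (z₀ : ℂ) :
    IsIrreducibleSolution α β (pathSolution α β π z₀) := by
  -- The base point of the path serves as its own origin.
  have hz : z₀ = node α n z₀ 0 := by simp [node]
  have hint : IsIntegralSolution α β z₀ (pathSolution α β π z₀) := by
    conv => arg 4; rw [hz]
    exact isIntegralSolution_pathSolution hn hmn h π 0
  have hprof := isProfile_pathSolution (z₀ := z₀) hα hm hn h π 0
  rw [← hz] at hprof
  refine ⟨hint.1, fun hone => ?_, fun A B hA hB hAB => ?_⟩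
  · have := pathSolution_mul (α := α) (β := β) π z₀
    rw [hone] at this
    have h2 := congrArg natDegree this
    rw [natDegree_prod_of_monic _ _ fun i _ => monic_X_sub_C _] at h2
    simp only [natDegree_X_sub_C, Prod.fst_one, Prod.snd_one, mul_one, natDegree_one,
      Finset.sum_const, Finset.card_univ, Fintype.card_fin, smul_eq_mul] at h2
    omega
  · have h1 : A.1 * B.1 ≠ 0 := by
      have := hint.1.1.ne_zero
      rwa [hAB] at this
    have h2 : A.2 * B.2 ≠ 0 := by
      have := hint.1.2.1.ne_zero
      rwa [hAB] at this
    obtain ⟨CA, hCA, -⟩ := hA.exists_isProfile hα hm hn h (left_ne_zero_of_mul h1)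
      (left_ne_zero_of_mul h2) z₀
    obtain ⟨CB, hCB, -⟩ := hB.exists_isProfile hα hm hn h (right_ne_zero_of_mul h1)
      (right_ne_zero_of_mul h2) z₀
    have hsum := isProfile_rootMultiplicity_mul h1 h2 hCA hCB
    rw [← hAB] at hsum
    have hC := hsum.unique hm hprof
    -- The roots of a factor are roots of the product, hence lie in the coset; a zero profile then
    -- excludes all roots.
    have const : ∀ {D : ℂ[X] × ℂ[X]} {CD : ℤ → ℕ}, D.1 ≠ 0 → D.2 ≠ 0 →
        (∀ z, D.1.IsRoot z ∨ D.2.IsRoot z →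
          ((pathSolution α β π z₀).1 * (pathSolution α β π z₀).2).IsRoot z) →
        IsProfile m n (fun e => D.1.rootMultiplicity (node α n z₀ e))
          (fun e => D.2.rootMultiplicity (node α n z₀ e)) CD → (∀ e, CD e = 0) →
        D.1.natDegree = 0 ∧ D.2.natDegree = 0 := by
      intro D CD hD1 hD2 hroot hCD h0
      have noroot : ∀ z, ¬ (D.1.IsRoot z ∨ D.2.IsRoot z) := by
        intro z hz
        obtain ⟨e, rfl⟩ := exists_node hn h (hint.2 z (hroot z hz))
        have := hCD.total e
        rw [h0, h0] at this
        rcases hz with hz | hz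
        · have := (rootMultiplicity_pos hD1).2 hz
          omega
        · have := (rootMultiplicity_pos hD2).2 hz
          omega
      constructor
      · by_contra hd
        obtain ⟨z, hz⟩ := IsAlgClosed.exists_root D.1 fun hc =>
          hd (natDegree_eq_zero_iff_degree_le_zero.2 hc.le)
        exact noroot z (Or.inl hz)
      · by_contra hd
        obtain ⟨z, hz⟩ := IsAlgClosed.exists_root D.2 fun hc =>
          hd (natDegree_eq_zero_iff_degree_le_zero.2 hc.le)
        exact noroot z (Or.inr hz)
    by_cases hA0 : ∀ e, CA e = 0
    · refine Or.inl (const (left_ne_zero_of_mul h1) (left_ne_zero_of_mul h2) ?_ hCA hA0)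
      rw [hAB]
      intro z hz
      simp only [Prod.fst_mul, Prod.snd_mul, root_mul]
      tauto
    · refine Or.inr (const (right_ne_zero_of_mul h1) (right_ne_zero_of_mul h2) ?_ hCB ?_)
      · rw [hAB]
        intro z hz
        simp only [Prod.fst_mul, Prod.snd_mul, root_mul]
        tauto
      · push Not at hA0
        obtain ⟨e₁, he₁⟩ := hA0
        intro e₂
        by_contra he₂
        obtain ⟨e, he⟩ := hCA.exists_two_le hmn hCB he₁ he₂
        have h3 := congrFun hC e
        have h4 := pathProfile_le_one π 0 hm hmn e
        omega

end solutions

end ShiftEq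

/-! ### The decomposition theorem -/

theorem theoremC (α β : ℂ) (hα : α ≠ 0) (hβ : β ≠ 0)
    (m n : ℕ) (hm : 0 < m) (hn : 0 < n) (hmn : Nat.Coprime m n)
    (h : (m : ℂ) * α + (n : ℂ) * β = 0)
    (c : ℂ ⧸ latticeGroup α β) (z₀ : ℂ) (hz₀ : (z₀ : ℂ ⧸ latticeGroup α β) = c)
    (p q : Polynomial ℂ) (hpq : IsIntegralSolution α β c (p, q)) :
    (∀ a : PathIn m n c, IsIrreducibleSolution α β (pathSolution α β a.1 (a.2 : ℂ))) ∧
    ∃! L : List (PathIn m n c),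
      List.IsChain (SouthEast z₀) L ∧
      (p, q) = (L.map fun a => pathSolution α β a.1 (a.2 : ℂ)).prod := by
  refine ⟨fun a => isIrreducibleSolution_pathSolution hα hm hn hmn h a.1 a.2, ?_⟩
  subst hz₀
  choose r hr using fun a : PathIn m n (z₀ : ℂ ⧸ latticeGroup α β) =>
    exists_node (z₀ := z₀) hn h a.2.2
  set f : PathIn m n (z₀ : ℂ ⧸ latticeGroup α β) → ℤ → ℕ := fun a => pathProfile a.1 (r a) with hf
  have hone : ∀ a e, f a e ≤ 1 := fun a e => pathProfile_le_one _ _ hm hmn e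
  have hpos : ∀ a, ∃ e, 0 < f a e := fun a =>
    ⟨r a, (pathProfile_pos_iff _ _ hm).2 ⟨0, (level_zero _ _).le, by simp [level_zero]⟩⟩
  have hinj : Function.Injective f := by
    intro a b hab
    obtain ⟨h1, h2⟩ := pathProfile_injective hm hmn hab
    exact Prod.ext h1 (Subtype.ext (by rw [hr a, hr b, h2]))
  have hint : ∀ a : PathIn m n (z₀ : ℂ ⧸ latticeGroup α β),
      IsIntegralSolution α β z₀ (pathSolution α β a.1 (a.2 : ℂ)) := by
    intro a
    rw [hr a]
    exact isIntegralSolution_pathSolution hn hmn h _ _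
  have hprof : ∀ L : List (PathIn m n (z₀ : ℂ ⧸ latticeGroup α β)), _ :=
    isProfile_list_prod (z₀ := z₀) (m := m) (n := n) (f := f) hint fun a => by
      rw [hr a]
      exact isProfile_pathSolution hα hm hn h _ _
  -- Inclusion of supports is transitive, so a chain is nested pairwise.
  have hchain : ∀ L, List.IsChain (SouthEast z₀) L ↔
      L.Pairwise fun a b => ∀ e, f b e ≤ f a e := by
    intro L
    have : IsTrans (PathIn m n (z₀ : ℂ ⧸ latticeGroup α β)) fun a b => ∀ e, f b e ≤ f a e :=
      ⟨fun _ _ _ h1 h2 e => (h2 e).trans (h1 e)⟩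
    rw [← List.isChain_iff_pairwise]
    have hrel : SouthEast z₀ = fun a b => ∀ e, f b e ≤ f a e := by
      funext a b
      exact propext (southEast_iff hα hβ hm hn hmn h rfl (hr a) (hr b))
    rw [hrel]
  simp only [hchain]
  obtain ⟨C, hC, hbdd⟩ := hpq.1.2.2.exists_isProfile hα hm hn h hpq.1.1.ne_zero
    hpq.1.2.1.ne_zero z₀
  -- Each non-empty layer `{C > i}` is closed under adding `m` and `n` by monotonicity of `C`, hence
  -- comes from a path.
  obtain ⟨L, hL, hsum⟩ := exists_list_sum_eq hone hbdd fun i hi => by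
    obtain ⟨π, t, hπ⟩ := exists_path_of_set hm hmn {e | i < C e} hi
      (by
        obtain ⟨B, hB⟩ := hC.low
        refine ⟨B, fun e he => ?_⟩
        by_contra hlt
        rw [Set.mem_ofPred_eq, hB e (by omega)] at he
        omega)
      (fun e he => lt_of_lt_of_le he (hC.add_m e)) (fun e he => lt_of_lt_of_le he (hC.add_n e))
    refine ⟨(π, ⟨node α n z₀ t, mk_node hn hmn h t⟩), fun e => ?_⟩
    rw [hf]
    dsimp only
    rw [← node_injective hα hn (hr (π, ⟨node α n z₀ t, mk_node hn hmn h t⟩))]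
    exact hπ e
  refine ⟨L, ⟨hL, ?_⟩, ?_⟩
  · have hLP := hprof L
    rw [funext hsum] at hLP
    refine hpq.eq_of_rootMultiplicity_eq hn h
      (isIntegralSolution_list_prod fun P hP => by
        obtain ⟨a, -, rfl⟩ := List.mem_map.1 hP
        exact hint a)
      (fun e => ?_) fun e => ?_
    · have := hC.up e
      have := hLP.up e
      omega
    · have := hC.down e
      have := hLP.down e
      omega
  · rintro L' ⟨hL', hprod⟩
    have hLP' := hprof L'
    rw [← hprod] at hLP'
    refine list_eq_of_sum_eq hinj hone hpos hL' hL fun e => ?_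
    rw [hsum]
    exact congrFun (hLP'.unique hm hC) e
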